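/- Let $(\Omega,\mathcal A,\mu)$ be a finite measure space, $\mathcal H$ a real Hilbert space, and $f\in L^2(\Omega;\mathcal H)$. Then $f$ has a Schmidt decomposition $$f=\sum_{i=1}^r\sigma_i u_i v_i\quad\text{in } L^2(\Omega;\mathcal H),$$ where $r=\operatorname{rank}(f)\in\mathbb N\cup\{\infty\}$ (with $r=0$ allowed), $(u_i)$ is orthonormal in $\mathcal H$, $(v_i)$ is orthonormal in $L^2(\Omega)$, and $\sigma_1\ge\sigma_2\ge\dots$ are positive. Fix any such decomposition and an integer $k\ge 1$ with $r\ge k$. For a representative of $f$ (again denoted by $f$) and $\mathbf y=(y_1,\dots,y_k)\in\Omega^k$, let $G^{(k)}(\mathbf y)=[\langle f(y_i),f(y_j)\rangle]_{i,j=1}^k$, let $\Pi_{\mathbf y}$ be the orthogonal projection of $\mathcal H$ onto $\operatorname{span}\{f(y_1),\dots,f(y_k)\}$, write $(\Pi_{\mathbf y}f)(y')=\Pi_{\mathbf y}f(y')$, and let $$\varrho(\mathbf y)=\frac{\det G^{(k)}(\mathbf y)}{\int_{\Omega^k}\det G^{(k)}\,d\mu^{\otimes k}}.$$ For every representative of $f$,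 $\det G^{(k)}$ is integrable with positive integral, so that $\varrho$ is well-defined; moreover $\varrho\ge 0$ and $\int_{\Omega^k}\varrho\,d\mu^{\otimes k}=1$. Furthermore: (i) For every representative of $f$ and every $\mathbf y\in\Omega^k$, the function $y'\mapsto f(y')-\Pi_{\mathbf y}f(y')$ is Bochner integrable and belongs to $L^2(\Omega;\mathcal H)$. For two representatives of $f$ these functions agree $\mu$-almost everywhere for $\mu^{\otimes k}$-almost every $\mathbf y$. Hence $\mathbf y\mapsto\|f-\Pi_{\mathbf y}f\|^2_{L^2(\Omega;\mathcal H)}$ is well-defined. (ii) There is an $\mathcal A^{\otimes k}$-measurable, $\mu^{\otimes k}$-integrable function $g:\Omega^k\to\mathbb R$ such that, for every representative of $f$, $\|f-\Pi_{\mathbf y}f\|^2_{L^2(\Omega;\mathcal H)}\,\varrho(\mathbf y)=g(\mathbf y)$ for $\mu^{\otimes k}$-almost every $\mathbf y$. Hence the expectation $$\mathbb E_\varrho\big(\|f-\Pi_{\mathbf y}f\|^2_{L^2(\Omega;\mathcal H)}\big)=\int_{\Omega^k}\|f-\Pi_{\mathbf y}f\|^2_{L^2(\Omega;\mathcal H)}\,\varrho(\mathbf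 y)\,d\mu^{\otimes k}(\mathbf y)$$ is well-defined, finite, and independent of the representative. (iii) The series $\sum_{i=k+1}^r\sigma_i^2$ converges and $$\sum_{i=k+1}^r\sigma_i^2\;\le\;\mathbb E_\varrho\big(\|f-\Pi_{\mathbf y}f\|^2_{L^2(\Omega;\mathcal H)}\big)\;\le\;(k+1)\sum_{i=k+1}^r\sigma_i^2.$$ -/

import Mathlib

open MeasureTheory
open scoped ENNReal

noncomputable section

/-- A Schmidt decomposition `f = ∑ σᵢ uᵢ vᵢ` (`i < rank`, counted from `0`, with `rank` possibly
infinite) of an element `f` of the Lebesgue-Bochner space `L²(Ω; H)`: the `uᵢ` are orthonormal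
in `H`, the `vᵢ` are orthonormal in `L²(Ω)`, the singular values `σᵢ` are positive and
nonincreasing, and the series converges in `L²(Ω; H)`. -/
structure SchmidtDecomposition {Ω : Type*} [MeasurableSpace Ω] {μ : Measure Ω}
    {H : Type*} [NormedAddCommGroup H] [InnerProductSpace ℝ H] (f : Lp H 2 μ) where
  /-- the number of positive singular values -/
  rank : ℕ∞
  /-- the left singular vectors -/
  u : {i : ℕ // (i : ℕ∞) < rank} → H
  /-- the right singular vectors -/
  v : {i : ℕ // (i : ℕ∞) < rank} → Lp ℝ 2 μ
  /-- the singular values -/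
  σ : {i : ℕ // (i : ℕ∞) < rank} → ℝ
  orthonormal_u : Orthonormal ℝ u
  orthonormal_v : Orthonormal ℝ v
  antitone_σ : Antitone σ
  σ_pos : ∀ i, 0 < σ i
  /-- `toSpanSingleton ℝ (u i)` is `c ↦ c • u i`, so the `i`-th term is the class of
  `y ↦ σ i • v i y • u i`. -/
  hasSum : HasSum
    (fun i => σ i • (ContinuousLinearMap.toSpanSingleton ℝ (u i)).compLp (v i)) f

/-- The squared singular values with (zero-based) index `i ≥ k`; these are the
`σᵢ²` with `k + 1 ≤ i ≤ r` if indices start from one. -/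
def SchmidtDecomposition.tailTerm {Ω : Type*} [MeasurableSpace Ω] {μ : Measure Ω}
    {H : Type*} [NormedAddCommGroup H] [InnerProductSpace ℝ H] {f : Lp H 2 μ}
    (S : SchmidtDecomposition f) (k : ℕ) :
    {i : {i : ℕ // (i : ℕ∞) < S.rank} // k ≤ i.1} → ℝ :=
  fun i => S.σ i.1 ^ 2

/-- The span of the samples `F (y₁), …, F (y_k)`. -/
def sampleSpan {Ω H : Type*} [NormedAddCommGroup H] [InnerProductSpace ℝ H]
    {k : ℕ} (F : Ω → H) (y : Fin k → Ω) : Submodule ℝ H :=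
  Submodule.span ℝ (Set.range fun i => F (y i))

instance sampleSpan_finiteDimensional {Ω H : Type*} [NormedAddCommGroup H] [InnerProductSpace ℝ H]
    {k : ℕ} (F : Ω → H) (y : Fin k → Ω) :
    FiniteDimensional ℝ (sampleSpan F y) :=
  FiniteDimensional.span_of_finite ℝ (Set.finite_range _)

/-- The function `y' ↦ F y' - Π_y F y'`, where `Π_y` is the orthogonal projection of `H` onto
the span of the samples. -/
def sampleResidual {Ω H : Type*} [NormedAddCommGroup H] [InnerProductSpace ℝ H]
    {k : ℕ} (F : Ω → H) (y : Fin k → Ω) : Ω → H :=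
  fun y' => F y' - (sampleSpan F y).starProjection (F y')

/-- The squared projection error `‖F - Π_y F‖²` in `L²(Ω; H)`. -/
def sampleErrorSq {Ω : Type*} [MeasurableSpace Ω] (μ : Measure Ω)
    {H : Type*} [NormedAddCommGroup H] [InnerProductSpace ℝ H]
    {k : ℕ} (F : Ω → H) (y : Fin k → Ω) : ℝ :=
  ∫ y', ‖sampleResidual F y y'‖ ^ 2 ∂μ

/-- The Gram determinant (volume) `det [⟪F (yᵢ), F (yⱼ)⟫]ᵢⱼ`. -/
def gramDet {Ω H : Type*} [NormedAddCommGroup H] [InnerProductSpace ℝ H]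
    {k : ℕ} (F : Ω → H) (y : Fin k → Ω) : ℝ :=
  (Matrix.gram ℝ fun i => F (y i)).det

/-- The volume sampling density `ϱ = det G / ∫ det G dμ^{⊗ k}`. -/
def volumeDensity {Ω : Type*} [MeasurableSpace Ω] (μ : Measure Ω)
    {H : Type*} [NormedAddCommGroup H] [InnerProductSpace ℝ H]
    {k : ℕ} (F : Ω → H) (y : Fin k → Ω) : ℝ :=
  gramDet F y / ∫ z : Fin k → Ω, gramDet F z ∂(Measure.pi fun _ => μ)

end

/-! ### The compact operator attached to an element of `L²(Ω; H)` -/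

section Existence

open Filter Topology
open scoped InnerProductSpace

/-! Write `D_k` for the integral of the `k`-point Gram determinant. By "base times height",
appending a point `x` to `y` multiplies the Gram determinant by `‖f x - Π_y f x‖²` (`gramDet_cons`).
Integrating over `x` and `y` turns the expected squared error into the ratio `D_{k+1} / D_k`
(`integral_sampleErrorSq_mul_gramDet`).

The functions `⟪u_i, f ·⟫ = σ_i v_i` are orthogonal, so Andréief's identity (`integral_det_sum_mul`)
evaluates `D_k` as the sum `T_k` of `∏ σ_{j a}²` over injective `k`-tuples `j`. For infinite rank
this is a limit of finite truncations (`tendsto_injectiveTupleSum`). What remains is `T_k τ ≤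
T_{k+1} ≤ (k + 1) T_k τ`, with `τ` the squared tail. Above: an injective `(k+1)`-tuple has a tail
index in one of its `k + 1` positions. Below: the indices omitted by an injective `k`-tuple weigh at
least `τ`, since the tail omits the `k` largest weights.

A Schmidt decomposition exists because `A : x ↦ ⟪x, f ·⟫` is compact: an eigenbasis of `A* A`
supplies the `u_i`, and normalizing `A u_i` gives `σ_i` and `v_i`. -/

/-- The linear map `x ↦ ⟪x, f ·⟫` from `H` to `L²(Ω)` attached to `f ∈ L²(Ω; H)`. -/
noncomputable def analysisOperator {Ω : Type*} [MeasurableSpace Ω] {μ : Measure Ω}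
    {H : Type*} [NormedAddCommGroup H] [InnerProductSpace ℝ H] :
    Lp H 2 μ →L[ℝ] H →L[ℝ] Lp ℝ 2 μ :=
  (ContinuousLinearMap.compLpL₂ 2 μ (innerSL ℝ)).flip

/-- The class of `y ↦ v y • u` in `L²(Ω; H)`. -/
noncomputable abbrev elementaryTensor {Ω : Type*} [MeasurableSpace Ω] {μ : Measure Ω}
    {H : Type*} [NormedAddCommGroup H] [InnerProductSpace ℝ H] (u : H) (v : Lp ℝ 2 μ) :
    Lp H 2 μ :=
  (ContinuousLinearMap.toSpanSingleton ℝ u).compLp v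

variable {Ω : Type*} [MeasurableSpace Ω] {μ : Measure Ω}
  {H : Type*} [NormedAddCommGroup H] [InnerProductSpace ℝ H]

theorem analysisOperator_ae (f : Lp H 2 μ) (x : H) :
    analysisOperator f x =ᵐ[μ] fun y => ⟪x, f y⟫_ℝ :=
  (innerSL ℝ x).coeFn_compLp f

theorem elementaryTensor_ae (u : H) (v : Lp ℝ 2 μ) :
    elementaryTensor u v =ᵐ[μ] fun y => v y • u := by
  filter_upwards [(ContinuousLinearMap.toSpanSingleton ℝ u).coeFn_compLp v] with y hy
  rw [hy, ContinuousLinearMap.toSpanSingleton_apply]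

theorem analysisOperator_elementaryTensor (u : H) (v : Lp ℝ 2 μ) (x : H) :
    analysisOperator (elementaryTensor u v) x = ⟪x, u⟫_ℝ • v := by
  apply Lp.ext
  filter_upwards [analysisOperator_ae (elementaryTensor u v) x, elementaryTensor_ae u v,
    Lp.coeFn_smul ⟪x, u⟫_ℝ v] with y h1 h2 h3
  rw [h1, h2, h3, inner_smul_right, Pi.smul_apply, smul_eq_mul, mul_comm]

theorem inner_elementaryTensor_left (u : H) (v : Lp ℝ 2 μ) (f : Lp H 2 μ) :
    ⟪elementaryTensor u v, f⟫_ℝ = ⟪v, analysisOperator f u⟫_ℝ := by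
  rw [L2.inner_def, L2.inner_def]
  apply integral_congr_ae
  filter_upwards [analysisOperator_ae f u, elementaryTensor_ae u v] with y h1 h2
  rw [h1, h2, inner_smul_left, real_inner_eq_re_inner ℝ, RCLike.inner_apply]
  simp [mul_comm]

theorem inner_elementaryTensor (u u' : H) (v v' : Lp ℝ 2 μ) :
    ⟪elementaryTensor u v, elementaryTensor u' v'⟫_ℝ = ⟪u, u'⟫_ℝ * ⟪v, v'⟫_ℝ := by
  rw [inner_elementaryTensor_left, analysisOperator_elementaryTensor, inner_smul_right]

theorem Orthonormal.elementaryTensor {ι : Type*} {u : ι → H} {v : ι → Lp ℝ 2 μ}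
    (hu : Orthonormal ℝ u) (hv : Orthonormal ℝ v) :
    Orthonormal ℝ fun i => elementaryTensor (u i) (v i) := by
  classical
  rw [orthonormal_iff_ite] at *
  intro i j
  rw [inner_elementaryTensor, hu, hv]
  split_ifs <;> simp

/-- `H` may be nonseparable, but the range of `f` is separable. Testing against a countable dense
subset costs one null set, and continuity then allows testing against `f y` itself. -/
theorem eq_zero_of_analysisOperator_eq_zero {f : Lp H 2 μ} (h : analysisOperator f = 0) :
    f = 0 := by
  have hf := Lp.stronglyMeasurable f
  apply (Lp.eq_zero_iff_ae_eq_zero).2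
  have key : ∀ᵐ y ∂μ, ∀ c ∈ Set.range f, ⟪c, f y⟫_ℝ = 0 := by
    obtain ⟨d, hdr, hd, hdense⟩ := hf.isSeparable_range.exists_countable_dense_subset
    have h1 : ∀ᵐ y ∂μ, ∀ c ∈ d, ⟪c, f y⟫_ℝ = 0 := by
      refine (ae_ball_iff hd).2 fun c _ => ?_
      filter_upwards [analysisOperator_ae f c,
        Lp.coeFn_zero ℝ 2 μ] with y h2 h3
      rw [← h2, h]
      simpa using h3
    filter_upwards [h1] with y hy c hc
    have hcl : IsClosed {c : H | ⟪c, f y⟫_ℝ = 0} := isClosed_eq (by fun_prop) (by fun_prop)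
    exact (closure_minimal (fun c hc => hy c hc) hcl) (hdense hc)
  filter_upwards [key] with y hy
  exact inner_self_eq_zero.1 (hy (f y) ⟨y, rfl⟩)

/-- Indicators give operators of rank at most one, and compact operators are closed under sums and
norm limits. -/
theorem isCompactOperator_analysisOperator (f : Lp H 2 μ) :
    IsCompactOperator (analysisOperator f) := by
  induction f using Lp.induction (p := 2) (hp_ne_top := ENNReal.ofNat_ne_top) with
  | indicatorConst c hs hμs =>
    rename_i s
    have h1 : (Lp.simpleFunc.indicatorConst 2 hs hμs.ne c : Lp H 2 μ)
        = elementaryTensor c (indicatorConstLp 2 hs hμs.ne (1 : ℝ)) := by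
      rw [Lp.simpleFunc.coe_indicatorConst, elementaryTensor,
        indicatorConstLp_eq_toSpanSingleton_compLp]
    rw [h1]
    have h2 : analysisOperator (elementaryTensor c (indicatorConstLp 2 hs hμs.ne (1 : ℝ)))
        = (ContinuousLinearMap.toSpanSingleton ℝ (indicatorConstLp 2 hs hμs.ne (1 : ℝ))).comp
          (innerSL ℝ c) := by
      ext1 x
      rw [analysisOperator_elementaryTensor]
      simp [real_inner_comm]
    rw [h2, ContinuousLinearMap.coe_comp]
    have h3 : IsCompactOperator (innerSL ℝ c) :=
      isCompactOperator_of_locallyCompactSpace_dom (innerSL ℝ c)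
    exact h3.clm_comp _
  | add hf hg _ h1 h2 =>
    rw [map_add]
    exact h1.add h2
  | isClosed =>
    exact isClosed_setOfPred_isCompactOperator.preimage
      (analysisOperator (Ω := Ω) (μ := μ) (H := H)).continuous

end Existence

/-! ### Orthonormal expansions and decreasing enumeration -/

section Enumeration

open Filter Topology
open scoped InnerProductSpace

/-- The family need not be complete in `E`, but it is a Hilbert basis of its closed span. -/
theorem Orthonormal.hasSum_inner_smul {E : Type*} [NormedAddCommGroup E] [InnerProductSpace ℝ E]
    [CompleteSpace E] {ι : Type*} {e : ι → E} (he : Orthonormal ℝ e) (x : E) :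
    HasSum (fun i => ⟪e i, x⟫_ℝ • e i)
      ((Submodule.span ℝ (Set.range e)).topologicalClosure.starProjection x) := by
  set U := (Submodule.span ℝ (Set.range e)).topologicalClosure with hU
  have : CompleteSpace U := (Submodule.isClosed_topologicalClosure _).completeSpace_coe
  have hmem : ∀ i, e i ∈ U := fun i =>
    Submodule.le_topologicalClosure _ (Submodule.subset_span ⟨i, rfl⟩)
  let e' : ι → U := fun i => ⟨e i, hmem i⟩
  have he' : Orthonormal ℝ e' := by
    exact ⟨fun i => he.1 i, fun i j hij => he.2 hij⟩
  have hbot : (Submodule.span ℝ (Set.range e'))ᗮ = ⊥ := by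
    rw [Submodule.eq_bot_iff]
    intro z hz
    have h1 : (z : E) ∈ (Submodule.span ℝ (Set.range e)).topologicalClosureᗮ := by
      rw [Submodule.orthogonal_closure, Submodule.mem_orthogonal]
      intro w hw
      induction hw using Submodule.span_induction with
      | mem w hw =>
        obtain ⟨i, rfl⟩ := hw
        exact (Submodule.mem_orthogonal _ _).1 hz (e' i) (Submodule.subset_span ⟨i, rfl⟩)
      | zero => simp
      | add a b _ _ ha hb => rw [inner_add_left, ha, hb, add_zero]
      | smul c a _ ha => rw [inner_smul_left, ha, mul_zero]
    have h2 := Submodule.inner_right_of_mem_orthogonal z.2 h1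
    exact Subtype.ext (inner_self_eq_zero.1 h2)
  have h := (HilbertBasis.mkOfOrthogonalEqBot he' hbot).hasSum_orthogonalProjectionOnto x
  have h2 := h.mapL U.subtypeL
  simpa [e', HilbertBasis.coe_mkOfOrthogonalEqBot] using h2

/-- A family of positive numbers, only finitely many of which exceed any given positive number,
can be enumerated in nonincreasing order along an initial segment of `ℕ`. -/
theorem exists_antitone_enumeration {ι : Type*} (σ : ι → ℝ) (hσ : ∀ i, 0 < σ i)
    (hfin : ∀ ε > 0, {i | ε ≤ σ i}.Finite) :
    ∃ (r : ℕ∞) (e : {n : ℕ // (n : ℕ∞) < r} ≃ ι), Antitone (σ ∘ e) := by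
  classical
  obtain ⟨r₀, hr₀⟩ := exists_wellFoundedLT ι
  -- Sort by decreasing `σ`, with an arbitrary linear order on `ι` breaking ties. The position of
  -- `j` will be its number `n j` of predecessors.
  let key : ι → ℝᵒᵈ ×ₗ ι := fun i => toLex (OrderDual.toDual (σ i), i)
  have key_inj : Function.Injective key := fun i j h => by
    have := congrArg (fun p => (ofLex p).2) h
    exact this
  have key_le : ∀ {i j}, key i ≤ key j → σ j ≤ σ i := by
    intro i j h
    rcases (Prod.Lex.le_iff).1 h with h | h
    · exact le_of_lt h
    · exact le_of_eq (congrArg OrderDual.ofDual h.1.symm)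
  have hI : ∀ j, {i | key i < key j}.Finite := fun j =>
    (hfin (σ j) (hσ j)).subset fun i hi => key_le (le_of_lt hi)
  let I : ι → Finset ι := fun j => (hI j).toFinset
  have memI : ∀ {i j}, i ∈ I j ↔ key i < key j := fun {i j} => (hI j).mem_toFinset
  let n : ι → ℕ := fun j => (I j).card
  have n_lt : ∀ {i j}, key i < key j → n i < n j := by
    intro i j h
    apply Finset.card_lt_card
    refine ⟨fun l hl => memI.2 ((memI.1 hl).trans h), fun hs => ?_⟩
    exact lt_irrefl _ (memI.1 (hs (memI.2 h)))
  have n_le : ∀ {i j}, n i ≤ n j → key i ≤ key j := fun {i j} h =>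
    not_lt.1 fun h' => absurd (n_lt h') (not_lt.2 h)
  have n_inj : Function.Injective n := fun i j h =>
    key_inj (le_antisymm (n_le h.le) (n_le h.ge))
  have n_surj : ∀ j, ∀ m < n j, ∃ i, n i = m := by
    intro j m hm
    -- The `n j` predecessors have distinct positions below `n j`, so they fill all of them.
    have himg : (I j).image n = Finset.range (n j) := by
      apply Finset.eq_of_subset_of_card_le
      · intro l hl
        obtain ⟨i, hi, rfl⟩ := Finset.mem_image.1 hl
        exact Finset.mem_range.2 (n_lt (memI.1 hi))
      · rw [Finset.card_image_of_injective _ n_inj, Finset.card_range]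
    obtain ⟨i, _, hi⟩ := Finset.mem_image.1 (himg ▸ Finset.mem_range.2 hm)
    exact ⟨i, hi⟩
  have hrange : ∃ r : ℕ∞, ∀ m : ℕ, (m : ℕ∞) < r ↔ m ∈ Set.range n := by
    by_cases h : ∀ m, m ∈ Set.range n
    · exact ⟨⊤, fun m => ⟨fun _ => h m, fun _ => ENat.natCast_lt_top m⟩⟩
    · push Not at h
      refine ⟨(Nat.find h : ℕ), fun m => ?_⟩
      rw [Nat.cast_lt, Nat.lt_find_iff]
      constructor
      · intro h'
        exact not_not.1 (h' m le_rfl)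
      · rintro ⟨j, rfl⟩ m hm hm'
        rcases hm.eq_or_lt with rfl | hlt
        · exact hm' ⟨j, rfl⟩
        · exact hm' (n_surj j m hlt)
  obtain ⟨r, hr⟩ := hrange
  let e : {m : ℕ // (m : ℕ∞) < r} ≃ ι :=
    (Equiv.subtypeEquivRight hr).trans (Equiv.ofInjective n n_inj).symm
  have hne : ∀ m, n (e m) = m := fun m =>
    Equiv.apply_ofInjective_symm n_inj ((Equiv.subtypeEquivRight hr) m)
  refine ⟨r, e, fun a b hab => ?_⟩
  apply key_le
  apply n_le
  rw [hne, hne]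
  exact hab

end Enumeration

/-! ### Existence of the Schmidt decomposition -/

section Existence

universe w

open Filter Topology
open scoped InnerProductSpace

variable {Ω : Type*} [MeasurableSpace Ω] {μ : Measure Ω}
  {H : Type w} [NormedAddCommGroup H] [InnerProductSpace ℝ H] [CompleteSpace H]

/-- There is a Hilbert basis of `H` whose image under `x ↦ ⟪x, f ·⟫` is orthogonal. -/
theorem exists_hilbertBasis_analysisOperator_orthogonal (f : Lp H 2 μ) :
    ∃ (ι : Type w) (b : HilbertBasis ι ℝ H),
      Pairwise fun i j => ⟪analysisOperator f (b i), analysisOperator f (b j)⟫_ℝ = 0 := by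
  set A := analysisOperator f with hA
  -- Since `⟪A x, A y⟫ = ⟪x, C y⟫`, orthogonal eigenvectors of `C` have orthogonal images under `A`.
  -- The eigenvalue `0` is kept, so the basis spans all of `H`.
  set C : H →L[ℝ] H := (ContinuousLinearMap.adjoint A).comp A with hC
  have hinner : ∀ x y, ⟪A x, A y⟫_ℝ = ⟪x, C y⟫_ℝ := fun x y => by
    rw [hC, ContinuousLinearMap.comp_apply, ContinuousLinearMap.adjoint_inner_right]
  have hcpt : IsCompactOperator C :=
    (isCompactOperator_analysisOperator f).clm_comp (ContinuousLinearMap.adjoint A)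
  have hsymm : (C : H →ₗ[ℝ] H).IsSymmetric := fun x y => by
    change ⟪C x, y⟫_ℝ = ⟪x, C y⟫_ℝ
    rw [← hinner, real_inner_comm, ← hinner, real_inner_comm]
  let G : ℝ → Submodule ℝ H := fun t => Module.End.eigenspace (C : Module.End ℝ H) t
  have hG : ∀ t x, x ∈ G t ↔ C x = t • x := fun t x => Module.End.mem_eigenspace_iff
  have hGc : ∀ t, CompleteSpace (G t) := fun t => by
    have : IsClosed (G t : Set H) := by
      have h : (G t : Set H) = {x | C x = t • x} := Set.ext fun x => hG t x
      rw [h]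
      exact isClosed_eq C.continuous (continuous_const_smul t)
    exact this.completeSpace_coe
  have hex : ∀ t, ∃ (w : Set (G t)) (b : HilbertBasis w ℝ (G t)), ⇑b = ((↑) : w → G t) :=
    fun t => exists_hilbertBasis ℝ (G t)
  choose w b hb using hex
  let e : (Σ t, w t) → H := fun p => (b p.1 p.2 : H)
  have he : Orthonormal ℝ e :=
    hsymm.orthogonalFamily_eigenspaces.orthonormal_sigma_orthonormal fun t => (b t).orthonormal
  have hbot : (Submodule.span ℝ (Set.range e))ᗮ = ⊥ := by
    have hT := ContinuousLinearMap.orthogonalComplement_iSup_eigenspaces_eq_bot hcpt hsymm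
    rw [eq_bot_iff, ← hT]
    intro z hz
    have hz' : ∀ t (i : w t), ⟪z, (b t i : H)⟫_ℝ = 0 := fun t i => by
      rw [real_inner_comm]
      exact (Submodule.mem_orthogonal _ _).1 hz (e ⟨t, i⟩) (Submodule.subset_span ⟨⟨t, i⟩, rfl⟩)
    have hle : (⨆ t, G t) ≤ (ℝ ∙ z)ᗮ := by
      refine iSup_le fun t x hx => ?_
      rw [Submodule.mem_orthogonal_singleton_iff_inner_right]
      have h1 := ((b t).hasSum_repr ⟨x, hx⟩).mapL ((innerSL ℝ z).comp (G t).subtypeL)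
      refine h1.unique ?_
      convert hasSum_zero using 2 with i
      rw [map_smul, ContinuousLinearMap.comp_apply, Submodule.subtypeL_apply, innerSL_apply_apply,
        hz', smul_zero]
    rw [Submodule.mem_orthogonal]
    intro x hx
    rw [real_inner_comm]
    exact Submodule.mem_orthogonal_singleton_iff_inner_right.1 (hle hx)
  refine ⟨_, HilbertBasis.mkOfOrthogonalEqBot he hbot, ?_⟩
  intro i j hij
  rw [HilbertBasis.coe_mkOfOrthogonalEqBot, hinner, (hG j.1 (e j)).1 (b j.1 j.2).2,
    inner_smul_right, he.2 hij, mul_zero]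

/-- Every element of `L²(Ω; H)` has a Schmidt decomposition. -/
theorem nonempty_schmidtDecomposition (f : Lp H 2 μ) : Nonempty (SchmidtDecomposition f) := by
  classical
  obtain ⟨ι₀, b, hb⟩ := exists_hilbertBasis_analysisOperator_orthogonal f
  set A := analysisOperator f with hA
  -- Basis vectors killed by `A` are dropped, so that `A (u i)` can be normalized.
  let ι := {i : ι₀ // A (b i) ≠ 0}
  let u : ι → H := fun i => b i
  let σ : ι → ℝ := fun i => ‖A (u i)‖
  let v : ι → Lp ℝ 2 μ := fun i => (σ i)⁻¹ • A (u i)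
  have hσ : ∀ i, 0 < σ i := fun i => norm_pos_iff.2 i.2
  have hAu : ∀ i, A (u i) = σ i • v i := fun i => by
    rw [smul_smul, mul_inv_cancel₀ (hσ i).ne', one_smul]
  have hu : Orthonormal ℝ u := b.orthonormal.comp _ Subtype.val_injective
  have hv : Orthonormal ℝ v := by
    refine ⟨fun i => ?_, fun i j hij => ?_⟩
    · rw [norm_smul, norm_inv, Real.norm_of_nonneg (hσ i).le, inv_mul_cancel₀ (hσ i).ne']
    · change ⟪(σ i)⁻¹ • A (u i), (σ j)⁻¹ • A (u j)⟫_ℝ = 0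
      rw [inner_smul_left, inner_smul_right,
        hb (fun h => hij (Subtype.ext h)), mul_zero, mul_zero]
  have het := hu.elementaryTensor hv
  have hcoef : ∀ i, ⟪elementaryTensor (u i) (v i), f⟫_ℝ = σ i := fun i => by
    rw [inner_elementaryTensor_left, ← hA, hAu, inner_smul_right, real_inner_self_eq_norm_sq,
      hv.1 i, one_pow, mul_one]
  obtain ⟨s, hs⟩ : ∃ s, HasSum (fun i => σ i • elementaryTensor (u i) (v i)) s := by
    have h := het.hasSum_inner_smul f
    simp only [hcoef] at h
    exact ⟨_, h⟩
  -- Bessel only gives convergence to some `s`. It equals `f` because the two operators agree on the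
  -- whole basis `b`, including the dropped vectors.
  have hsf : s = f := by
    rw [← sub_eq_zero]
    apply eq_zero_of_analysisOperator_eq_zero
    rw [map_sub, sub_eq_zero]
    have hbasis : ∀ j, analysisOperator s (b j) = A (b j) := by
      intro j
      have h1 := hs.mapL ((ContinuousLinearMap.apply ℝ (Lp ℝ 2 μ) (b j)).comp
        (analysisOperator (μ := μ) (H := H)))
      have h2 : ∀ i, ((ContinuousLinearMap.apply ℝ (Lp ℝ 2 μ) (b j)).comp
          (analysisOperator (μ := μ) (H := H))) (σ i • elementaryTensor (u i) (v i))
          = if (i : ι₀) = j then A (b j) else 0 := by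
        intro i
        rw [map_smul, ContinuousLinearMap.comp_apply, ContinuousLinearMap.apply_apply,
          analysisOperator_elementaryTensor]
        rw [orthonormal_iff_ite.1 b.orthonormal j i]
        by_cases h : (i : ι₀) = j
        · rw [if_pos h, if_pos h.symm, one_smul, ← hAu, ← h]
        · rw [if_neg h, if_neg fun h' => h h'.symm, zero_smul, smul_zero]
      simp only [h2] at h1
      refine h1.unique ?_
      by_cases hj : A (b j) = 0
      · simp only [hj, ite_self]
        exact hasSum_zero
      · have := hasSum_ite_eq (⟨j, hj⟩ : ι) (A (b j))
        simpa only [Subtype.ext_iff] using this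
    refine ContinuousLinearMap.ext_on (s := Set.range b) ?_ ?_
    · exact Submodule.dense_iff_topologicalClosure_eq_top.2 b.dense_span
    · rintro _ ⟨j, rfl⟩
      exact hbasis j
  rw [hsf] at hs
  have hfin : ∀ ε > 0, {i | ε ≤ σ i}.Finite := by
    intro ε hε
    have h1 : Summable fun i => σ i ^ 2 := by
      have := het.inner_products_summable (x := f)
      simpa only [hcoef, Real.norm_of_nonneg (hσ _).le] using this
    have h2 := h1.tendsto_cofinite_zero.eventually_lt_const (pow_pos hε 2)
    refine (Filter.eventually_cofinite.1 h2).subset fun i hi => ?_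
    exact not_lt.2 (pow_le_pow_left₀ hε.le hi 2)
  obtain ⟨r, e, he⟩ := exists_antitone_enumeration σ hσ hfin
  exact ⟨{
    rank := r
    u := u ∘ e
    v := v ∘ e
    σ := σ ∘ e
    orthonormal_u := hu.comp _ e.injective
    orthonormal_v := hv.comp _ e.injective
    antitone_σ := he
    σ_pos := fun i => hσ _
    hasSum := (e.hasSum_iff (f := fun i => σ i • elementaryTensor (u i) (v i))).2 hs }⟩

end Existence

/-! ### Inequalities for sums over injective tuples -/

section Combinatorics

open Finset

theorem Fin.insertNth_injective_iff {α : Type*} {n : ℕ} (a : Fin (n + 1)) (x : α) (j : Fin n → α) :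
    Function.Injective (a.insertNth (α := fun _ => α) x j) ↔
      x ∉ Set.range j ∧ Function.Injective j := by
  constructor
  · intro h
    refine ⟨?_, fun b c hbc => ?_⟩
    · rintro ⟨b, hb⟩
      refine Fin.succAbove_ne a b (h ?_)
      rw [Fin.insertNth_apply_succAbove, Fin.insertNth_apply_same, hb]
    · apply a.succAbove_right_injective
      apply h
      rw [Fin.insertNth_apply_succAbove, Fin.insertNth_apply_succAbove, hbc]
  · rintro ⟨hx, hj⟩ b c hbc
    induction b using a.succAboveCases <;> induction c using a.succAboveCases
    · rfl
    · rename_i c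
      rw [Fin.insertNth_apply_succAbove, Fin.insertNth_apply_same] at hbc
      exact absurd ⟨c, hbc.symm⟩ hx
    · rename_i b
      rw [Fin.insertNth_apply_succAbove, Fin.insertNth_apply_same] at hbc
      exact absurd ⟨b, hbc⟩ hx
    · rw [Fin.insertNth_apply_succAbove, Fin.insertNth_apply_succAbove] at hbc
      rw [hj hbc]

theorem Fin.insertNthEquiv_mk {α : Type*} {n : ℕ} (a : Fin (n + 1)) (x : α) (j : Fin n → α) :
    Fin.insertNthEquiv (fun _ => α) a (x, j) = a.insertNth (α := fun _ => α) x j := rfl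

open scoped Classical in
/-- The sum of `∏ a, w (j a)` over all injective `k`-tuples `j`, that is, `k!` times the `k`-th
elementary symmetric polynomial in the weights `w`. -/
noncomputable def injectiveTupleSum {ι : Type*} [Fintype ι] (w : ι → ℝ) (k : ℕ) : ℝ :=
  ∑ j : Fin k → ι, if Function.Injective j then ∏ a, w (j a) else 0

variable {ι : Type*} [Fintype ι] {w : ι → ℝ} {k : ℕ}

theorem prod_le_injectiveTupleSum (hw : ∀ i, 0 ≤ w i) {j : Fin k → ι}
    (hj : Function.Injective j) : ∏ a, w (j a) ≤ injectiveTupleSum w k := by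
  classical
  have h := single_le_sum (f := fun j : Fin k → ι => if Function.Injective j then ∏ a, w (j a) else 0)
    (s := univ) (fun j _ => by
      split_ifs
      · exact prod_nonneg fun a _ => hw _
      · exact le_rfl) (mem_univ j)
  rw [if_pos hj] at h
  unfold injectiveTupleSum
  convert h

-- Split off the entry in position `0`: it ranges over the indices that the other `k` entries omit.
open scoped Classical in
theorem injectiveTupleSum_succ (w : ι → ℝ) (k : ℕ) :
    injectiveTupleSum w (k + 1) = ∑ j : Fin k → ι,
      if Function.Injective j then (∏ a, w (j a)) * ∑ i with i ∉ Set.range j, w i else 0 := by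
  unfold injectiveTupleSum
  rw [← (Fin.insertNthEquiv (fun _ : Fin (k + 1) => ι) 0).sum_comp, Fintype.sum_prod_type_right]
  refine sum_congr rfl fun j _ => ?_
  simp only [Fin.insertNthEquiv_mk, Fin.insertNth_injective_iff]
  by_cases hj : Function.Injective j
  · rw [if_pos hj, mul_sum, sum_filter]
    refine sum_congr rfl fun i _ => ?_
    simp only [hj, and_true]
    split_ifs
    · rfl
    · rw [Fin.prod_univ_succAbove _ 0]
      simp [mul_comm]
  · simp [hj]

/-- If `p` selects all but `k` indices, then the `(k + 1)`-tuple sum is at most `k + 1` times the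
`k`-tuple sum times the total weight of `p`. -/
theorem injectiveTupleSum_succ_le (hw : ∀ i, 0 ≤ w i) (p : ι → Prop) [DecidablePred p]
    (hp : #{i | ¬ p i} = k) :
    injectiveTupleSum w (k + 1) ≤ (k + 1) * (injectiveTupleSum w k * ∑ i with p i, w i) := by
  classical
  have hex : ∀ j : Fin (k + 1) → ι, Function.Injective j → ∃ a, p (j a) := by
    intro j hj
    by_contra! h
    have h1 := card_le_card_of_injOn (s := univ) (t := ({i | ¬ p i} : Finset ι)) j
      (fun a _ => by simpa using h a) hj.injOn
    rw [hp, card_univ, Fintype.card_fin] at h1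
    omega
  -- Union bound over the position of an entry in `p`; this is the source of the factor `k + 1`.
  have h1 : injectiveTupleSum w (k + 1) ≤ ∑ a : Fin (k + 1), ∑ j : Fin (k + 1) → ι,
      if Function.Injective j ∧ p (j a) then ∏ b, w (j b) else 0 := by
    rw [sum_comm]
    unfold injectiveTupleSum
    refine sum_le_sum fun j _ => ?_
    split_ifs with hj
    · obtain ⟨a, ha⟩ := hex j hj
      have h := single_le_sum (f := fun a => if Function.Injective j ∧ p (j a) then
        ∏ b, w (j b) else 0) (s := univ) (fun a _ => by
          split_ifs
          · exact prod_nonneg fun a _ => hw _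
          · exact le_rfl) (mem_univ a)
      rwa [if_pos ⟨hj, ha⟩] at h
    · exact sum_nonneg fun a _ => by simp [hj]
  -- Deleting entry `a` leaves an injective tuple; the bound forgets that the deleted index must
  -- avoid it.
  have h2 : ∀ a : Fin (k + 1), (∑ j : Fin (k + 1) → ι,
      if Function.Injective j ∧ p (j a) then ∏ b, w (j b) else 0)
        ≤ injectiveTupleSum w k * ∑ i with p i, w i := by
    intro a
    rw [← (Fin.insertNthEquiv (fun _ : Fin (k + 1) => ι) a).sum_comp, Fintype.sum_prod_type_right]
    unfold injectiveTupleSum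
    rw [sum_mul]
    refine sum_le_sum fun j _ => ?_
    rw [mul_sum, sum_filter]
    refine sum_le_sum fun i _ => ?_
    simp only [Fin.insertNthEquiv_mk, Fin.insertNth_injective_iff, Fin.insertNth_apply_same]
    rw [Fin.prod_univ_succAbove _ a]
    simp only [Fin.insertNth_apply_same, Fin.insertNth_apply_succAbove]
    have hprod : 0 ≤ w i * ∏ b, w (j b) := mul_nonneg (hw i) (prod_nonneg fun a _ => hw _)
    by_cases hpi : p i <;> by_cases hj : Function.Injective j <;>
      by_cases hi : i ∈ Set.range j <;> simp only [hpi, hj, hi] <;>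
      simp [mul_comm, hprod]
  refine h1.trans ((sum_le_sum fun a _ => h2 a).trans ?_)
  simp

/-- If `p` selects all but the `k` largest weights, then the `(k + 1)`-tuple sum is at least the
`k`-tuple sum times the total weight of `p`. -/
theorem le_injectiveTupleSum_succ (hw : ∀ i, 0 ≤ w i) (p : ι → Prop) [DecidablePred p]
    (hp : #{i | ¬ p i} = k) (hle : ∀ i j, ¬ p i → p j → w j ≤ w i) :
    injectiveTupleSum w k * ∑ i with p i, w i ≤ injectiveTupleSum w (k + 1) := by
  classical
  rw [injectiveTupleSum_succ, injectiveTupleSum, sum_mul]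
  refine sum_le_sum fun j _ => ?_
  split_ifs with hj
  swap
  · rw [zero_mul]
  refine mul_le_mul_of_nonneg_left ?_ (prod_nonneg fun a _ => hw _)
  set R : Finset ι := univ.image j with hR
  set N : Finset ι := {i | ¬ p i} with hN
  have hRc : #R = k := by rw [hR, card_image_of_injective _ hj, card_univ, Fintype.card_fin]
  -- `R` and `N` both have `k` elements, so their differences are in bijection, and every weight in
  -- `N` dominates every weight outside it.
  have hcard : #(R \ N) = #(N \ R) := by
    have h1 := card_sdiff_add_card_inter R N
    have h2 := card_sdiff_add_card_inter N R
    rw [inter_comm N R] at h2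
    omega
  have h1 : ∑ i ∈ R \ N, w i ≤ ∑ i ∈ N \ R, w i := by
    have e := equivOfCardEq hcard
    rw [← sum_coe_sort, ← sum_coe_sort (N \ R), ← e.sum_comp]
    refine sum_le_sum fun i _ => hle _ _ ?_ ?_
    · have := (e i).2
      simp only [hN, mem_sdiff, mem_filter, mem_univ, true_and] at this
      exact this.1
    · have := i.2
      simp only [hN, mem_sdiff, mem_filter, mem_univ, true_and, not_not] at this
      exact this.2
  have h2 : ∑ i ∈ R, w i ≤ ∑ i ∈ N, w i := by
    rw [← sum_inter_add_sum_sdiff R N w, ← sum_inter_add_sum_sdiff N R w, inter_comm N R]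
    linarith
  have h3 : ∑ i with i ∉ Set.range j, w i = ∑ i, w i - ∑ i ∈ R, w i := by
    rw [eq_sub_iff_add_eq, add_comm, ← sum_filter_add_sum_filter_not univ (fun i => i ∈ R)]
    simp [hR]
  have h4 : ∑ i with p i, w i = ∑ i, w i - ∑ i ∈ N, w i := by
    rw [eq_sub_iff_add_eq, ← sum_filter_add_sum_filter_not univ p]
  rw [h3, h4]
  linarith

end Combinatorics

/-! ### Gram determinants: base times height and a crude bound -/

section Gram

open scoped InnerProductSpace

/-- With the columns fixed, the determinant is a linear functional `L` of the vector defining row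
`0`. `L` vanishes on `K` because of equal rows, so `x` may be replaced by its residual, whose row is
`(‖r‖², 0, …, 0)`. -/
theorem Matrix.det_gram_cons {H : Type*} [NormedAddCommGroup H] [InnerProductSpace ℝ H] {k : ℕ}
    (x : H) (z : Fin k → H) (K : Submodule ℝ H) [K.HasOrthogonalProjection]
    (hK : K = Submodule.span ℝ (Set.range z)) :
    (Matrix.gram ℝ (Fin.cons x z : Fin (k + 1) → H)).det
      = (Matrix.gram ℝ z).det * ‖x - K.starProjection x‖ ^ 2 := by
  set c : Fin (k + 1) → H := Fin.cons x z with hc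
  let L : H →ₗ[ℝ] ℝ :=
    { toFun := fun w => ((Matrix.gram ℝ c).updateRow 0 fun j => ⟪w, c j⟫_ℝ).det
      map_add' := fun w w' => by
        rw [← Matrix.det_updateRow_add]
        congr 2
        ext j
        exact inner_add_left _ _ _
      map_smul' := fun t w => by
        rw [RingHom.id_apply, smul_eq_mul, ← Matrix.det_updateRow_smul]
        congr 2
        ext j
        exact real_inner_smul_left _ _ _ }
  have hLx : L x = (Matrix.gram ℝ c).det := by
    change ((Matrix.gram ℝ c).updateRow 0 _).det = _
    congr 1
    have : (fun j => ⟪x, c j⟫_ℝ) = Matrix.gram ℝ c 0 := by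
      ext j
      rw [Matrix.gram_apply, hc, Fin.cons_zero]
    rw [this]
    exact Matrix.updateRow_eq_self _ _
  have hLz : ∀ p ∈ K, L p = 0 := by
    intro p hp
    rw [hK] at hp
    induction hp using Submodule.span_induction with
    | mem p hp =>
      obtain ⟨i, rfl⟩ := hp
      refine Matrix.det_zero_of_row_eq (Fin.succ_ne_zero i).symm ?_
      ext j
      rw [Matrix.updateRow_self, Matrix.updateRow_ne (Fin.succ_ne_zero i), Matrix.gram_apply, hc,
        Fin.cons_succ]
    | zero => exact map_zero L
    | add a b _ _ ha hb => rw [map_add, ha, hb, add_zero]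
    | smul t a _ ha => rw [map_smul, ha, smul_zero]
  set r := x - K.starProjection x with hr
  have hrK : r ∈ Kᗮ := K.sub_starProjection_mem_orthogonal x
  have hrz : ∀ i, ⟪r, z i⟫_ℝ = 0 := fun i =>
    (Submodule.mem_orthogonal' _ _).1 hrK _ (hK ▸ Submodule.subset_span ⟨i, rfl⟩)
  have hrx : ⟪r, x⟫_ℝ = ‖r‖ ^ 2 := by
    have h1 : x = r + K.starProjection x := by rw [hr, sub_add_cancel]
    nth_rewrite 1 [h1]
    rw [inner_add_right, (Submodule.mem_orthogonal' _ _).1 hrK _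
      (K.starProjection_apply_mem x), add_zero, real_inner_self_eq_norm_sq]
  have hLr : L r = (Matrix.gram ℝ z).det * ‖r‖ ^ 2 := by
    change ((Matrix.gram ℝ c).updateRow 0 fun j => ⟪r, c j⟫_ℝ).det = _
    rw [Matrix.det_succ_row_zero, Fin.sum_univ_succ, Finset.sum_eq_zero]
    · simp only [Matrix.updateRow_self, hc, Fin.cons_zero, hrx, Fin.val_zero, pow_zero, one_mul,
        add_zero]
      rw [mul_comm]
      congr 2
    · intro i _
      simp only [Matrix.updateRow_self, hc, Fin.cons_succ, hrz, mul_zero, zero_mul]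
  rw [← hLx, ← hLr, hr, map_sub, hLz _ (K.starProjection_apply_mem x), sub_zero]

/-- Each of the `k!` Leibniz terms is at most `∏ c (π a) c a = ∏ c a ^ 2`. This supplies the
dominating function for Gram determinants and their truncations alike. -/
theorem Matrix.abs_det_le_of_abs_le_mul {k : ℕ} (M : Matrix (Fin k) (Fin k) ℝ) (c : Fin k → ℝ)
    (hM : ∀ a b, |M a b| ≤ c a * c b) : |M.det| ≤ k.factorial * ∏ a, c a ^ 2 := by
  rw [Matrix.det_apply]
  refine (Finset.abs_sum_le_sum_abs _ _).trans ?_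
  have h : ∀ π : Equiv.Perm (Fin k), |Equiv.Perm.sign π • ∏ a, M (π a) a| ≤ ∏ a, c a ^ 2 := by
    intro π
    have h1 : |Equiv.Perm.sign π • ∏ a, M (π a) a| = ∏ a, |M (π a) a| := by
      rw [← Finset.abs_prod]
      rcases Int.units_eq_one_or (Equiv.Perm.sign π) with h | h <;> rw [h] <;> simp
    rw [h1]
    refine (Finset.prod_le_prod (fun a _ => abs_nonneg _) fun a _ => hM (π a) a).trans ?_
    rw [Finset.prod_mul_distrib, Equiv.prod_comp π c, ← Finset.prod_mul_distrib]
    simp only [pow_two, le_refl]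
  refine (Finset.sum_le_sum fun π _ => h π).trans ?_
  rw [Finset.sum_const, Finset.card_univ, Fintype.card_perm, Fintype.card_fin, nsmul_eq_mul]

theorem gramDet_cons {Ω H : Type*} [NormedAddCommGroup H] [InnerProductSpace ℝ H] {k : ℕ}
    (F : Ω → H) (x : Ω) (y : Fin k → Ω) :
    gramDet F (Fin.cons x y : Fin (k + 1) → Ω) = gramDet F y * ‖sampleResidual F y x‖ ^ 2 := by
  have h : (fun i => F ((Fin.cons x y : Fin (k + 1) → Ω) i))
      = (Fin.cons (F x) (fun i => F (y i)) : Fin (k + 1) → H) := by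
    ext i
    induction i using Fin.cases <;> simp
  unfold gramDet sampleResidual
  rw [h]
  exact Matrix.det_gram_cons (F x) (fun i => F (y i)) (sampleSpan F y) rfl

theorem gramDet_nonneg {Ω H : Type*} [NormedAddCommGroup H] [InnerProductSpace ℝ H] {k : ℕ}
    (F : Ω → H) (y : Fin k → Ω) : 0 ≤ gramDet F y :=
  (Matrix.posSemidef_gram ℝ fun i => F (y i)).det_nonneg

theorem abs_gramDet_le {Ω H : Type*} [NormedAddCommGroup H] [InnerProductSpace ℝ H] {k : ℕ}
    (F : Ω → H) (y : Fin k → Ω) : |gramDet F y| ≤ k.factorial * ∏ a, ‖F (y a)‖ ^ 2 :=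
  Matrix.abs_det_le_of_abs_le_mul _ _ fun _ _ => abs_real_inner_le_norm _ _

end Gram

/-! ### Andréief's identity -/

section Integral

open scoped InnerProductSpace

theorem Matrix.det_of_ite_eq {ι : Type*} [DecidableEq ι] {k : ℕ} (w : ι → ℝ) (j : Fin k → ι)
    [Decidable (Function.Injective j)] :
    (Matrix.of fun a b => if j a = j b then w (j a) else 0).det
      = if Function.Injective j then ∏ a, w (j a) else 0 := by
  split_ifs with hj
  · rw [← Matrix.det_diagonal]
    congr 1
    ext a b
    simp [Matrix.diagonal_apply, hj.eq_iff]
  · obtain ⟨a, b, hab, hne⟩ : ∃ a b, j a = j b ∧ a ≠ b := by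
      simpa [Function.Injective] using hj
    refine Matrix.det_zero_of_row_eq hne ?_
    ext c
    simp [hab]

/-- Andréief's identity for orthogonal functions. -/
theorem integral_det_sum_mul {Ω : Type*} [MeasurableSpace Ω] {μ : Measure Ω} [IsFiniteMeasure μ]
    {ι : Type*} [Fintype ι] [DecidableEq ι] (ψ : ι → Ω → ℝ) (w : ι → ℝ)
    (hψ : ∀ i, MemLp (ψ i) 2 μ) (horth : ∀ i j, ∫ y, ψ i y * ψ j y ∂μ = if i = j then w i else 0)
    (k : ℕ) :
    ∫ y : Fin k → Ω, (Matrix.of fun a b => ∑ i, ψ i (y a) * ψ i (y b)).det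
      ∂(Measure.pi fun _ => μ) = injectiveTupleSum w k := by
  classical
  -- Factors are regrouped by the variable `y a`, whence `π⁻¹`, so that the integral factorizes.
  have hdet : ∀ y : Fin k → Ω, (Matrix.of fun a b => ∑ i, ψ i (y a) * ψ i (y b)).det
      = ∑ π : Equiv.Perm (Fin k), ∑ j : Fin k → ι,
        ((Equiv.Perm.sign π : ℤ) : ℝ) * ∏ a, (ψ (j (π⁻¹ a)) (y a) * ψ (j a) (y a)) := by
    intro y
    rw [Matrix.det_apply']
    refine Finset.sum_congr rfl fun π _ => ?_
    simp only [Matrix.of_apply]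
    rw [Fintype.prod_sum, Finset.mul_sum]
    refine Finset.sum_congr rfl fun j _ => ?_
    congr 1
    rw [Finset.prod_mul_distrib, Finset.prod_mul_distrib]
    congr 1
    exact Fintype.prod_equiv π _ _ fun a => by simp
  have hint : ∀ (π : Equiv.Perm (Fin k)) (j : Fin k → ι),
      Integrable (fun y : Fin k → Ω => ((Equiv.Perm.sign π : ℤ) : ℝ) *
        ∏ a, (ψ (j (π⁻¹ a)) (y a) * ψ (j a) (y a))) (Measure.pi fun _ => μ) := fun π j =>
    (Integrable.fintype_prod (f := fun a y => ψ (j (π⁻¹ a)) y * ψ (j a) y)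
      fun a => (hψ _).integrable_mul (hψ _)).const_mul _
  simp_rw [hdet]
  rw [integral_finsetSum _ fun π _ => integrable_finsetSum _ fun j _ => hint π j]
  simp_rw [integral_finsetSum _ fun j _ => hint _ j, integral_const_mul]
  rw [Finset.sum_comm]
  refine Finset.sum_congr rfl fun j _ => ?_
  -- For fixed `j`, the sum over `π` is the Leibniz expansion of a determinant that is diagonal or
  -- has two equal rows.
  rw [← Matrix.det_of_ite_eq, Matrix.det_apply', ← Equiv.sum_comp (Equiv.inv _)]
  refine Finset.sum_congr rfl fun π _ => ?_
  rw [integral_fintype_prod_eq_prod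
    (f := fun a y => ψ (j ((Equiv.inv (Equiv.Perm (Fin k)) π)⁻¹ a)) y * ψ (j a) y)]
  simp [horth]

end Integral

/-! ### Independence of the representative, measurability and Fubini -/

section Representatives

open Filter Topology
open scoped InnerProductSpace

section Pointwise

variable {Ω H : Type*} [NormedAddCommGroup H] [InnerProductSpace ℝ H] {k : ℕ}

theorem gramDet_congr {F F' : Ω → H} {y : Fin k → Ω} (h : ∀ a, F (y a) = F' (y a)) :
    gramDet F y = gramDet F' y := by
  unfold gramDet
  simp only [h]

theorem sampleSpan_congr {F F' : Ω → H} {y : Fin k → Ω} (h : ∀ a, F (y a) = F' (y a)) :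
    sampleSpan F y = sampleSpan F' y := by
  unfold sampleSpan
  simp only [h]

end Pointwise

theorem integrable_prod_norm_sq {Ω : Type*} [MeasurableSpace Ω] {μ : Measure Ω}
    [IsFiniteMeasure μ] {E : Type*} [NormedAddCommGroup E] {F : Ω → E} (hF : MemLp F 2 μ) (k : ℕ) :
    Integrable (fun y : Fin k → Ω => k.factorial * ∏ a, ‖F (y a)‖ ^ 2)
      (Measure.pi fun _ => μ) := by
  refine Integrable.const_mul ?_ _
  exact Integrable.fintype_prod (f := fun _ x => ‖F x‖ ^ 2)
    fun _ => (memLp_two_iff_integrable_sq_norm hF.1).1 hF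

variable {Ω : Type*} [MeasurableSpace Ω] {μ : Measure Ω}
  {H : Type*} [NormedAddCommGroup H] [InnerProductSpace ℝ H] {k : ℕ}

theorem memLp_sampleResidual {F : Ω → H} {p : ℝ≥0∞} (hF : MemLp F p μ) (y : Fin k → Ω) :
    MemLp (sampleResidual F y) p μ :=
  hF.sub ((sampleSpan F y).starProjection.comp_memLp' hF)

theorem integral_gramDet_cons (F : Ω → H) (y : Fin k → Ω) :
    ∫ x, gramDet F (Fin.cons x y : Fin (k + 1) → Ω) ∂μ = sampleErrorSq μ F y * gramDet F y := by
  simp_rw [gramDet_cons, integral_const_mul]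
  rw [mul_comm]
  rfl

theorem sampleResidual_ae_eq {F F' : Ω → H} (hF : F =ᵐ[μ] F') {y : Fin k → Ω}
    (h : ∀ a, F (y a) = F' (y a)) : sampleResidual F y =ᵐ[μ] sampleResidual F' y := by
  filter_upwards [hF] with x hx
  simp only [sampleResidual, hx, sampleSpan_congr h]

theorem sampleErrorSq_congr {F F' : Ω → H} (hF : F =ᵐ[μ] F') {y : Fin k → Ω}
    (h : ∀ a, F (y a) = F' (y a)) : sampleErrorSq μ F y = sampleErrorSq μ F' y :=
  integral_congr_ae ((sampleResidual_ae_eq hF h).fun_comp fun x => ‖x‖ ^ 2)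

variable [IsFiniteMeasure μ]

/-- Almost every sample avoids a given null set in all coordinates, so the pointwise congruence
lemmas apply to two representatives. -/
theorem ae_pi_forall {p : Ω → Prop} (h : ∀ᵐ x ∂μ, p x) :
    ∀ᵐ y : Fin k → Ω ∂(Measure.pi fun _ => μ), ∀ a, p (y a) :=
  ae_all_iff.2 fun a => (Measure.quasiMeasurePreserving_eval (fun _ => μ) a).ae h

theorem gramDet_ae_eq {F F' : Ω → H} (hF : F =ᵐ[μ] F') :
    gramDet (k := k) F =ᵐ[Measure.pi fun _ => μ] gramDet F' := by
  filter_upwards [ae_pi_forall hF] with y hy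
  exact gramDet_congr hy

theorem volumeDensity_congr {F F' : Ω → H} (hF : F =ᵐ[μ] F') {y : Fin k → Ω}
    (h : ∀ a, F (y a) = F' (y a)) : volumeDensity μ F y = volumeDensity μ F' y := by
  unfold volumeDensity
  rw [gramDet_congr h, integral_congr_ae (gramDet_ae_eq hF)]

theorem measurable_gramDet {F : Ω → H} (hF : StronglyMeasurable F) :
    Measurable (gramDet (k := k) F) := by
  unfold gramDet
  simp_rw [Matrix.det_apply', Matrix.gram_apply]
  refine Finset.measurable_sum _ fun π _ => (Finset.measurable_prod _ fun a _ => ?_).const_mul _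
  exact ((hF.comp_measurable (measurable_pi_apply _)).inner
    (hF.comp_measurable (measurable_pi_apply _))).measurable

theorem integrable_gramDet {F : Ω → H} (hFm : StronglyMeasurable F) (hF : MemLp F 2 μ) (k : ℕ) :
    Integrable (gramDet (k := k) F) (Measure.pi fun _ => μ) := by
  refine (integrable_prod_norm_sq hF k).mono' (measurable_gramDet hFm).aestronglyMeasurable ?_
  exact Eventually.of_forall fun y => abs_gramDet_le F y

theorem integrable_gramDet_cons {F : Ω → H} (hFm : StronglyMeasurable F) (hF : MemLp F 2 μ)
    (k : ℕ) : Integrable (fun p : Ω × (Fin k → Ω) => gramDet F (Fin.cons p.1 p.2 : Fin (k + 1) → Ω))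
      (μ.prod (Measure.pi fun _ => μ)) := by
  have h := ((measurePreserving_piFinSuccAbove (fun _ : Fin (k + 1) => μ) 0).symm _)
  have h2 := h.integrable_comp_emb (MeasurableEquiv.measurableEmbedding _)
    |>.2 (integrable_gramDet hFm hF (k + 1))
  refine h2.congr (Eventually.of_forall fun p => ?_)
  simp [MeasurableEquiv.piFinSuccAbove_symm_apply, Fin.insertNthEquiv]

theorem integrable_sampleErrorSq_mul_gramDet {F : Ω → H} (hFm : StronglyMeasurable F)
    (hF : MemLp F 2 μ) (k : ℕ) :
    Integrable (fun y : Fin k → Ω => sampleErrorSq μ F y * gramDet F y)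
      (Measure.pi fun _ => μ) := by
  have h := (integrable_gramDet_cons hFm hF k).integral_prod_right
  simpa only [integral_gramDet_cons] using h

/-- Writing the product as a partial integral of the `(k + 1)`-point Gram determinant avoids any
measurability question about `y ↦ Π_y`. -/
theorem measurable_sampleErrorSq_mul_gramDet {F : Ω → H} (hFm : StronglyMeasurable F) (k : ℕ) :
    Measurable (fun y : Fin k → Ω => sampleErrorSq μ F y * gramDet F y) := by
  have hm : Measurable fun p : Ω × (Fin k → Ω) => (Fin.cons p.1 p.2 : Fin (k + 1) → Ω) := by
    refine measurable_pi_iff.2 fun i => ?_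
    induction i using Fin.cases with
    | zero => exact measurable_fst
    | succ i => exact (measurable_pi_apply i).comp measurable_snd
  have h := ((measurable_gramDet (k := k + 1) hFm).comp hm).stronglyMeasurable.integral_prod_left'
    (μ := μ)
  simpa only [Function.comp_apply, integral_gramDet_cons] using h.measurable

theorem integral_sampleErrorSq_mul_gramDet {F : Ω → H} (hFm : StronglyMeasurable F)
    (hF : MemLp F 2 μ) (k : ℕ) :
    ∫ y : Fin k → Ω, sampleErrorSq μ F y * gramDet F y ∂(Measure.pi fun _ => μ)
      = ∫ y : Fin (k + 1) → Ω, gramDet F y ∂(Measure.pi fun _ => μ) := by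
  have h := ((measurePreserving_piFinSuccAbove (fun _ : Fin (k + 1) => μ) 0).symm _)
  rw [← h.integral_comp' (g := gramDet F)]
  simp_rw [← integral_gramDet_cons]
  rw [← integral_prod_symm _ (integrable_gramDet_cons hFm hF k)]
  refine integral_congr_ae (Eventually.of_forall fun p => ?_)
  simp [MeasurableEquiv.piFinSuccAbove_symm_apply, Fin.insertNthEquiv]

end Representatives

/-! ### Gram integrals as limits of injective tuple sums -/

section Schmidt

open Filter Topology
open scoped InnerProductSpace

variable {Ω : Type*} [MeasurableSpace Ω] {μ : Measure Ω}
  {H : Type*} [NormedAddCommGroup H] [InnerProductSpace ℝ H] {f : Lp H 2 μ}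

namespace SchmidtDecomposition

theorem analysisOperator_u (S : SchmidtDecomposition f) (i) :
    analysisOperator f (S.u i) = S.σ i • S.v i := by
  classical
  have h1 := S.hasSum.mapL ((ContinuousLinearMap.apply ℝ (Lp ℝ 2 μ) (S.u i)).comp
    (analysisOperator (μ := μ) (H := H)))
  refine h1.unique ?_
  convert hasSum_ite_eq i (S.σ i • S.v i) using 2 with j
  rw [map_smul, ContinuousLinearMap.comp_apply, ContinuousLinearMap.apply_apply]
  erw [analysisOperator_elementaryTensor]
  rw [orthonormal_iff_ite.1 S.orthonormal_u i j]
  by_cases h : j = i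
  · subst h; simp
  · rw [if_neg h, if_neg fun h' => h h'.symm, zero_smul, smul_zero]

theorem integral_inner_mul_inner (S : SchmidtDecomposition f) (i j) [Decidable (i = j)] :
    ∫ y, ⟪S.u i, f y⟫_ℝ * ⟪S.u j, f y⟫_ℝ ∂μ = if i = j then S.σ i ^ 2 else 0 := by
  classical
  have h1 : ∫ y, ⟪S.u i, f y⟫_ℝ * ⟪S.u j, f y⟫_ℝ ∂μ
      = ⟪analysisOperator f (S.u i), analysisOperator f (S.u j)⟫_ℝ := by
    rw [L2.inner_def]
    refine integral_congr_ae ?_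
    filter_upwards [analysisOperator_ae f (S.u i), analysisOperator_ae f (S.u j)] with y h1 h2
    rw [h1, h2]
    simp [mul_comm]
  rw [h1, S.analysisOperator_u, S.analysisOperator_u, real_inner_smul_left, real_inner_smul_right,
    orthonormal_iff_ite.1 S.orthonormal_v i j]
  split_ifs with h
  · rw [h]; ring
  · simp

theorem summable_sq (S : SchmidtDecomposition f) : Summable fun i => S.σ i ^ 2 := by
  have het := S.orthonormal_u.elementaryTensor S.orthonormal_v
  have h := het.inner_products_summable (x := f)
  refine h.congr fun i => ?_
  rw [inner_elementaryTensor_left, S.analysisOperator_u, real_inner_smul_right,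
    real_inner_self_eq_norm_sq, S.orthonormal_v.1 i, one_pow, mul_one,
    Real.norm_of_nonneg (S.σ_pos i).le]

/-- The projection onto the closed span of the `u i` fixes every term of the series, hence `f`, so
almost every `f y` lies in that span. The null set does not depend on `z`, which allows `z = f (y
b)` later. -/
theorem hasSum_inner_mul_inner_ae [CompleteSpace H] (S : SchmidtDecomposition f) :
    ∀ᵐ y ∂μ, ∀ z, HasSum (fun i => ⟪S.u i, f y⟫_ℝ * ⟪S.u i, z⟫_ℝ) ⟪f y, z⟫_ℝ := by
  let U := (Submodule.span ℝ (Set.range S.u)).topologicalClosure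
  have hP : U.starProjection.compLp f = f := by
    have h1 := S.hasSum.mapL (U.starProjection.compLpL 2 μ)
    refine h1.unique ?_
    convert S.hasSum using 2 with i
    rw [map_smul]
    congr 1
    apply Lp.ext
    filter_upwards [ContinuousLinearMap.coeFn_compLpL U.starProjection
      (elementaryTensor (S.u i) (S.v i)), elementaryTensor_ae (S.u i) (S.v i)] with y h1 h2
    erw [h1, h2]
    rw [map_smul, Submodule.starProjection_eq_self_iff.2]
    exact Submodule.le_topologicalClosure _ (Submodule.subset_span ⟨i, rfl⟩)
  filter_upwards [U.starProjection.coeFn_compLp f] with y hy z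
  have h2 : HasSum _ (U.starProjection (f y)) := S.orthonormal_u.hasSum_inner_smul (f y)
  rw [hP] at hy
  rw [← hy] at h2
  have h3 := h2.mapL (innerSL ℝ z)
  simpa [inner_smul_right, real_inner_comm] using h3

-- Andréief's identity evaluates the kernels truncated to `s`. Cauchy–Schwarz and Bessel bound their
-- entries by `‖f (y a)‖ * ‖f (y b)‖` uniformly in `s`, so dominated convergence applies.
open scoped Classical in
theorem tendsto_injectiveTupleSum [IsFiniteMeasure μ] [CompleteSpace H]
    (S : SchmidtDecomposition f) (k : ℕ) :
    Tendsto (fun s : Finset {i : ℕ // (i : ℕ∞) < S.rank} =>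
        injectiveTupleSum (fun i : s => S.σ i ^ 2) k) atTop
      (𝓝 (∫ y : Fin k → Ω, gramDet f y ∂(Measure.pi fun _ => μ))) := by
  have hfm := Lp.stronglyMeasurable f
  have hf := Lp.memLp f
  have hψm : ∀ i, StronglyMeasurable fun y => ⟪S.u i, f y⟫_ℝ := fun i =>
    stronglyMeasurable_const.inner hfm
  have hψ : ∀ i, MemLp (fun y => ⟪S.u i, f y⟫_ℝ) 2 μ := fun i => hf.const_inner _
  have hint : ∀ s : Finset {i : ℕ // (i : ℕ∞) < S.rank},
      injectiveTupleSum (fun i : s => S.σ i ^ 2) k = ∫ y : Fin k → Ω, (Matrix.of fun a b =>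
        ∑ i ∈ s, ⟪S.u i, f (y a)⟫_ℝ * ⟪S.u i, f (y b)⟫_ℝ).det ∂(Measure.pi fun _ => μ) := by
    intro s
    rw [← integral_det_sum_mul (fun (i : s) y => ⟪S.u i, f y⟫_ℝ) _ (fun i => hψ i) (fun i j => by
      rw [S.integral_inner_mul_inner]; simp only [Subtype.ext_iff])]
    refine integral_congr_ae (Eventually.of_forall fun y => ?_)
    simp only
    congr 2
    ext a b
    exact Finset.sum_coe_sort s fun i => ⟪S.u i, f (y a)⟫_ℝ * ⟪S.u i, f (y b)⟫_ℝ
  simp_rw [hint]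
  refine tendsto_integral_filter_of_dominated_convergence
    (fun y => k.factorial * ∏ a, ‖f (y a)‖ ^ 2) ?_ ?_ (integrable_prod_norm_sq hf k) ?_
  · refine Eventually.of_forall fun s => Measurable.aestronglyMeasurable ?_
    simp_rw [Matrix.det_apply', Matrix.of_apply]
    refine Finset.measurable_sum _ fun π _ => (Finset.measurable_prod _ fun a _ => ?_).const_mul _
    refine Finset.measurable_sum _ fun i _ => ?_
    exact ((hψm i).measurable.comp (measurable_pi_apply _)).mul
      ((hψm i).measurable.comp (measurable_pi_apply _))
  · refine Eventually.of_forall fun s => Eventually.of_forall fun y => ?_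
    refine Matrix.abs_det_le_of_abs_le_mul _ _ fun a b => ?_
    rw [Matrix.of_apply]
    refine abs_le_of_sq_le_sq ?_ (by positivity)
    refine (Finset.sum_mul_sq_le_sq_mul_sq _ _ _).trans ?_
    rw [mul_pow]
    have hB := fun x => S.orthonormal_u.sum_inner_products_le x (s := s)
    simp only [Real.norm_eq_abs, sq_abs] at hB
    exact mul_le_mul (hB _) (hB _) (Finset.sum_nonneg fun i _ => sq_nonneg _) (sq_nonneg _)
  · filter_upwards [ae_pi_forall S.hasSum_inner_mul_inner_ae] with y hy
    have hcont : Continuous fun M : Matrix (Fin k) (Fin k) ℝ => M.det :=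
      continuous_id.matrix_det
    refine (hcont.tendsto _).comp ?_
    refine tendsto_pi_nhds.2 fun a => tendsto_pi_nhds.2 fun b => ?_
    exact hy a (f (y b))

end SchmidtDecomposition

end Schmidt

/-! ### Passing to the limit in the combinatorial bounds -/

section Bounds

open Filter Topology

namespace SchmidtDecomposition

variable {Ω : Type*} [MeasurableSpace Ω] {μ : Measure Ω}
  {H : Type*} [NormedAddCommGroup H] [InnerProductSpace ℝ H] {f : Lp H 2 μ}
  (S : SchmidtDecomposition f) {k : ℕ}

/-- The first `k` indices of a Schmidt decomposition of rank at least `k`. -/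
def firstIndex (hk : (k : ℕ∞) ≤ S.rank) (a : Fin k) : {i : ℕ // (i : ℕ∞) < S.rank} :=
  ⟨a, lt_of_lt_of_le (Nat.cast_lt.2 a.2) hk⟩

theorem firstIndex_injective (hk : (k : ℕ∞) ≤ S.rank) : Function.Injective (S.firstIndex hk) :=
  fun _ _ h => Fin.ext (congrArg Subtype.val h)

theorem card_lt_of_firstIndex_mem (hk : (k : ℕ∞) ≤ S.rank)
    {s : Finset {i : ℕ // (i : ℕ∞) < S.rank}} (hs : ∀ a, S.firstIndex hk a ∈ s) :
    (Finset.univ.filter fun i : s => ¬ k ≤ i.1.1).card = k := by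
  classical
  have h : (Finset.univ.filter fun i : s => ¬ k ≤ i.1.1)
      = Finset.univ.image fun a : Fin k => (⟨S.firstIndex hk a, hs a⟩ : s) := by
    ext i
    simp only [Finset.mem_filter, Finset.mem_univ, true_and, Finset.mem_image]
    constructor
    · intro hi
      exact ⟨⟨i.1.1, not_le.1 hi⟩, rfl⟩
    · rintro ⟨a, rfl⟩
      exact not_le.2 a.2
  rw [h, Finset.card_image_of_injective, Finset.card_univ, Fintype.card_fin]
  exact fun a b hab => S.firstIndex_injective hk (congrArg Subtype.val hab)

theorem summable_tailTerm (k : ℕ) : Summable (S.tailTerm k) :=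
  S.summable_sq.comp_injective Subtype.val_injective

theorem tendsto_tail (k : ℕ) :
    Tendsto (fun s : Finset {i : ℕ // (i : ℕ∞) < S.rank} =>
      ∑ i : s with k ≤ i.1.1, S.σ i ^ 2) atTop (𝓝 (∑' i, S.tailTerm k i)) := by
  have h : HasSum ((fun i : {i : ℕ // (i : ℕ∞) < S.rank} => S.σ i ^ 2) ∘
    ((↑) : {i : {i : ℕ // (i : ℕ∞) < S.rank} | k ≤ i.1} → _)) (∑' i, S.tailTerm k i) :=
    (S.summable_tailTerm k).hasSum
  rw [hasSum_subtype_iff_indicator] at h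
  refine h.congr fun s => ?_
  rw [Finset.sum_filter, ← Finset.sum_coe_sort s]
  refine Finset.sum_congr rfl fun i _ => ?_
  rw [Set.indicator_apply]
  rfl

theorem eventually_firstIndex_mem (hk : (k : ℕ∞) ≤ S.rank) :
    ∀ᶠ s : Finset {i : ℕ // (i : ℕ∞) < S.rank} in atTop, ∀ a, S.firstIndex hk a ∈ s :=
  eventually_all.2 fun a => (eventually_ge_atTop {S.firstIndex hk a}).mono fun _ hs =>
    Finset.singleton_subset_iff.1 hs

variable [IsFiniteMeasure μ] [CompleteSpace H]

/-- The tuple of the first `k` indices contributes a fixed positive amount to every large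
truncation, so positivity survives the limit. -/
theorem integral_gramDet_pos (hk : (k : ℕ∞) ≤ S.rank) :
    0 < ∫ y : Fin k → Ω, gramDet f y ∂(Measure.pi fun _ => μ) := by
  classical
  refine lt_of_lt_of_le (b := ∏ a, S.σ (S.firstIndex hk a) ^ 2)
    (Finset.prod_pos fun a _ => pow_pos (S.σ_pos _) 2) ?_
  refine ge_of_tendsto (S.tendsto_injectiveTupleSum k) ?_
  filter_upwards [S.eventually_firstIndex_mem hk] with s hs
  exact prod_le_injectiveTupleSum (w := fun i : s => S.σ i ^ 2) (fun i => sq_nonneg _)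
    (j := fun a => ⟨S.firstIndex hk a, hs a⟩)
    (fun a b hab => S.firstIndex_injective hk (congrArg Subtype.val hab))

theorem integral_gramDet_succ_le (hk : (k : ℕ∞) ≤ S.rank) :
    ∫ y : Fin (k + 1) → Ω, gramDet f y ∂(Measure.pi fun _ => μ)
      ≤ (k + 1) * ((∫ y : Fin k → Ω, gramDet f y ∂(Measure.pi fun _ => μ))
        * ∑' i, S.tailTerm k i) := by
  classical
  refine le_of_tendsto_of_tendsto (S.tendsto_injectiveTupleSum (k + 1))
    (((S.tendsto_injectiveTupleSum k).mul (S.tendsto_tail k)).const_mul _) ?_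
  filter_upwards [S.eventually_firstIndex_mem hk] with s hs
  exact injectiveTupleSum_succ_le (fun i => sq_nonneg _) (fun i : s => k ≤ i.1.1)
    (S.card_lt_of_firstIndex_mem hk hs)

theorem le_integral_gramDet_succ (hk : (k : ℕ∞) ≤ S.rank) :
    (∫ y : Fin k → Ω, gramDet f y ∂(Measure.pi fun _ => μ)) * ∑' i, S.tailTerm k i
      ≤ ∫ y : Fin (k + 1) → Ω, gramDet f y ∂(Measure.pi fun _ => μ) := by
  classical
  refine le_of_tendsto_of_tendsto ((S.tendsto_injectiveTupleSum k).mul (S.tendsto_tail k))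
    (S.tendsto_injectiveTupleSum (k + 1)) ?_
  filter_upwards [S.eventually_firstIndex_mem hk] with s hs
  refine le_injectiveTupleSum_succ (fun i => sq_nonneg _) (fun i : s => k ≤ i.1.1)
    (S.card_lt_of_firstIndex_mem hk hs) fun i j hi hj => ?_
  exact pow_le_pow_left₀ (S.σ_pos _).le (S.antitone_σ ((not_le.1 hi).le.trans hj)) 2

end SchmidtDecomposition

end Bounds

/-- Every `f ∈ L²(Ω; H)` has a Schmidt decomposition, and whenever its rank is at least `k`, the
volume sampling density is a probability density, the squared projection error is well defined,
its product with the density has a measurable version, and its expectation lies between the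
squared singular value tail and `k + 1` times that tail. Representatives `F` of the class `f` are
arbitrary. -/
theorem mainTheorem2 {Ω : Type*} [MeasurableSpace Ω] (μ : Measure Ω) [IsFiniteMeasure μ]
    {H : Type*} [NormedAddCommGroup H] [InnerProductSpace ℝ H] [CompleteSpace H]
    (f : Lp H 2 μ) :
    Nonempty (SchmidtDecomposition f) ∧
    ∀ (S : SchmidtDecomposition f) (k : ℕ), 1 ≤ k → (k : ℕ∞) ≤ S.rank →
      -- the density is well defined and is a probability density
      (∀ F : Ω → H, F =ᵐ[μ] f →
        Integrable (gramDet (k := k) F) (Measure.pi fun _ => μ) ∧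
        0 < ∫ y : Fin k → Ω, gramDet F y ∂(Measure.pi fun _ => μ) ∧
        (∀ y : Fin k → Ω, 0 ≤ volumeDensity μ F y) ∧
        ∫ y : Fin k → Ω, volumeDensity μ F y ∂(Measure.pi fun _ => μ) = 1) ∧
      -- (i) the residual lies in `L²` for every `y`
      (∀ F : Ω → H, F =ᵐ[μ] f → ∀ y : Fin k → Ω,
        Integrable (sampleResidual F y) μ ∧ MemLp (sampleResidual F y) 2 μ) ∧
      -- and is, up to null sets, independent of the representative
      (∀ F F' : Ω → H, F =ᵐ[μ] f → F' =ᵐ[μ] f →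
        ∀ᵐ y : Fin k → Ω ∂(Measure.pi fun _ => μ),
          sampleResidual F y =ᵐ[μ] sampleResidual F' y) ∧
      -- (ii) measurable version for the product `σ`-algebra, the same for all representatives
      (∃ g : (Fin k → Ω) → ℝ, Measurable g ∧ Integrable g (Measure.pi fun _ => μ) ∧
        ∀ F : Ω → H, F =ᵐ[μ] f →
          (fun y : Fin k → Ω => sampleErrorSq μ F y * volumeDensity μ F y)
            =ᵐ[Measure.pi fun _ => μ] g) ∧
      -- (iii) bounds on the expectation
      Summable (S.tailTerm k) ∧
      (∀ F : Ω → H, F =ᵐ[μ] f →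
        ∑' i, S.tailTerm k i ≤
          ∫ y : Fin k → Ω, sampleErrorSq μ F y * volumeDensity μ F y
            ∂(Measure.pi fun _ => μ) ∧
        ∫ y : Fin k → Ω, sampleErrorSq μ F y * volumeDensity μ F y
            ∂(Measure.pi fun _ => μ) ≤
          ((k : ℝ) + 1) * ∑' i, S.tailTerm k i) := by
  refine ⟨nonempty_schmidtDecomposition f, fun S k _ hk => ?_⟩
  have hfm := Lp.stronglyMeasurable f
  have hf := Lp.memLp f
  set D : ℝ := ∫ y : Fin k → Ω, gramDet f y ∂(Measure.pi fun _ => μ)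
  have hDpos : 0 < D := S.integral_gramDet_pos hk
  have hDF : ∀ F : Ω → H, F =ᵐ[μ] f →
      ∫ y : Fin k → Ω, gramDet F y ∂(Measure.pi fun _ => μ) = D := fun F hF =>
    integral_congr_ae (gramDet_ae_eq hF)
  -- Built from the strongly measurable representative provided by `Lp`, so `g` is measurable for
  -- the product `σ`-algebra itself.
  let g : (Fin k → Ω) → ℝ := fun y => sampleErrorSq μ f y * gramDet f y / D
  have hg : ∀ F : Ω → H, F =ᵐ[μ] f →
      (fun y : Fin k → Ω => sampleErrorSq μ F y * volumeDensity μ F y)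
        =ᵐ[Measure.pi fun _ => μ] g := by
    intro F hF
    filter_upwards [ae_pi_forall hF] with y hy
    rw [sampleErrorSq_congr hF hy, volumeDensity_congr hF hy, volumeDensity]
    exact (mul_div_assoc _ _ _).symm
  have hgint : ∫ y, g y ∂(Measure.pi fun _ => μ)
      = (∫ y : Fin (k + 1) → Ω, gramDet f y ∂(Measure.pi fun _ => μ)) / D := by
    rw [integral_div, integral_sampleErrorSq_mul_gramDet hfm hf]
  refine ⟨fun F hF => ⟨?_, ?_, fun y => ?_, ?_⟩, fun F hF y => ?_, fun F F' hF hF' => ?_,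
    ⟨g, ?_, ?_, hg⟩, S.summable_tailTerm k, fun F hF => ?_⟩
  · exact (integrable_gramDet hfm hf k).congr (gramDet_ae_eq hF).symm
  · rw [hDF F hF]
    exact hDpos
  · rw [volumeDensity, hDF F hF]
    exact div_nonneg (gramDet_nonneg F y) hDpos.le
  · simp only [volumeDensity]
    rw [integral_div, hDF F hF, div_self hDpos.ne']
  · have h := memLp_sampleResidual ((memLp_congr_ae hF).2 hf) y
    exact ⟨h.integrable one_le_two, h⟩
  · filter_upwards [ae_pi_forall (hF.trans hF'.symm)] with y hy
    exact sampleResidual_ae_eq (hF.trans hF'.symm) hy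
  · exact (measurable_sampleErrorSq_mul_gramDet hfm k).div_const D
  · exact (integrable_sampleErrorSq_mul_gramDet hfm hf k).div_const D
  · rw [integral_congr_ae (hg F hF), hgint, le_div_iff₀ hDpos, div_le_iff₀ hDpos]
    constructor
    · rw [mul_comm]
      exact S.le_integral_gramDet_succ hk
    · rw [mul_assoc, mul_comm (∑' i, S.tailTerm k i)]
      exact S.integral_gramDet_succ_le hk
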